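/- **Setting.** Consider the control system $\dot x=f(x)+g(x)u$ with $x\in\mathbb{R}^n$, $f,g$ continuous, inputs in a set $U\subseteq\mathbb{R}^m$, a reference control signal $u_r:\mathbb{R}_{\ge0}\to U$, and a locally Lipschitz, strictly increasing $\alpha:\mathbb{R}\to\mathbb{R}$ with $\alpha(0)=0$. A continuously differentiable $h:\mathbb{R}^n\to\mathbb{R}$ is a *control barrier function (CBF) for a compact set $S$, valid on $D$*, where $S\subseteq\operatorname{int}(D)$ (for instance $D\supseteq S$ open), if $h>0$ on $\operatorname{int}(S)$, $h<0$ on $D\setminus S$, $h=0$ on $\operatorname{bd}(S)$, and $\sup_{u\in U}\langle\nabla h(x),f(x)+g(x)u\rangle\ge-\alpha(h(x))$ for all $x\in D$. Let $s>0$, $b>0$ and let $\bar\phi(r)=\max(0,1-r)^p\,q(r)$ be a radial profile of Wendland's form: $q$ is a real polynomial of degree less than $p$ and $\bar\phi\ge0$ on $[0,\infty)$. Let $k\ge1$ and, for $i=1,\dots,k$, let $$h_i(x)=\sum_{j=1}^{J_i}\theta^{(i)}_j\,\bar\phi\big(\|x-z^{(i)}_j\|_2/s\big)-b$$ be a CBF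 for the compact set $S_i$, valid on $D_i$ (in particular, $h_i$ is continuously differentiable on $\mathbb{R}^n$). Put $H=\max_ih_i$ and $C=\bigcup_iS_i$. For $\varepsilon>0$, a state $x$ and $w\in U$, let $\mathrm{QP}_\varepsilon(x,w)$ be the problem of minimizing $\|u-w\|_2^2$ over all $u\in U$ with $$\langle\nabla h_i(x),f(x)+g(x)u\rangle\ge-\alpha(H(x))\quad\text{for all } i \text{ with } |h_i(x)-H(x)|\le\varepsilon .$$ **Theorem.** Assume: 1. (Persistent feasibility) $\varepsilon>0$ is such that for every $t\ge0$ the problem $\mathrm{QP}_\varepsilon(x,u_r(t))$ has a solution for all $x\in C$, bounded uniformly in $x\in C$. 2. (Decay buffer) For all $i,j$: $z^{(i)}_j\in D_i$, and if $\theta^{(i)}_j>0$ then every point of $\operatorname{bd}(D_i)$ has distance at least $s$ from $z^{(i)}_j$. Then: - $h_i(x)<0$ for every $i$ and every $x\in\mathbb{R}^n\setminus D_i$. - $C\subseteq\bigcup_iD_i$, and $H$ is a valid non-smooth CBF for $C$: $H$ is locally Lipschitz, $C$ is compact, $C=\{x\in\mathbb{R}^n:H(x)\ge0\}$, $H=0$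 on $\operatorname{bd}(C)$, and $\sup_{u\in U}\inf_{\xi\in\partial H(x)}\langle\xi,f(x)+g(x)u\rangle\ge-\alpha(H(x))$ for all $x\in C$, where $\partial H(x)$ is Clarke's generalized gradient. - $C$ is forward invariant under the controls generated by $H$. That is, for every open set $W\supseteq C$ and every $T\ge0$, an absolutely continuous $x:[0,T]\to\mathbb{R}^n$ with $x(0)\in C$ satisfies $x(t)\in C$ for all $t\in[0,T]$ in each of the following two cases: (i) for almost every $t$ with $x(t)\in W$ one has $\dot x(t)=f(x(t))+g(x(t))u$ for some solution $u$ of $\mathrm{QP}_\varepsilon(x(t),u_r(t))$; (ii) $x$ is a Filippov solution of $\dot x=f(x)+g(x)\kappa(t,x)$, where $\kappa:\mathbb{R}_{\ge0}\times\mathbb{R}^n\to\mathbb{R}^m$ is measurable, locally bounded in $x$ for each $t$, and $\kappa(t,x)$ solves $\mathrm{QP}_\varepsilon(x,u_r(t))$ for all $t\ge0$ and $x\in W$. -/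

import Mathlib

open MeasureTheory Set Filter Topology

noncomputable section

namespace MaxCBF

/-- States and inputs: `Euc n` is `ℝⁿ` with the Euclidean norm. -/
abbrev Euc (n : ℕ) := EuclideanSpace ℝ (Fin n)

/-! ### Compactly supported radial basis functions -/

/-- The profile `r ↦ (1 - r)₊ ^ p * q(r)`. -/
def wendlandProfile (p : ℕ) (q : Polynomial ℝ) (r : ℝ) : ℝ :=
  (max 0 (1 - r)) ^ p * q.eval r

/-- The profile is of Wendland's form: `q` has degree less than `p`, and (as for all of Wendland's
functions) the profile takes nonnegative values. Positive definiteness and the minimality of the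
degree, which Wendland's functions have as well, are not asked for. -/
structure IsWendlandForm (p : ℕ) (q : Polynomial ℝ) : Prop where
  degree_lt : q.natDegree < p
  nonneg : ∀ r : ℝ, 0 ≤ r → 0 ≤ wendlandProfile p q r

/-- `h(x) = φ_s(x, Z)ᵀ θ - b`, where `φ_s(x, z) = φ(‖x - z‖ / s)`. -/
def rbfCBF {n J : ℕ} (φ : ℝ → ℝ) (s b : ℝ) (Z : Fin J → Euc n) (θ : Fin J → ℝ) (x : Euc n) : ℝ :=
  (∑ j, φ (‖x - Z j‖ / s) * θ j) - b

/-! ### Control barrier functions -/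

/-- Locally Lipschitz extended class-`𝒦` function. -/
structure IsExtClassK (α : ℝ → ℝ) : Prop where
  strictMono : StrictMono α
  map_zero : α 0 = 0
  locallyLipschitz : LocallyLipschitz α

/-- `h` is a control barrier function for the compact set `S`, valid on the region `D`, for the
system `ẋ = f(x) + g(x) u` with inputs in `U`. The region is any set that has `S` in its interior
(so any open `D ⊇ S`, but also a compact one around `S`), and `h` is continuously differentiable on
the whole space. The supremum is taken in the extended reals. -/
structure IsCBF {n m : ℕ} (f : Euc n → Euc n) (g : Euc n → Euc m →L[ℝ] Euc n)
    (U : Set (Euc m)) (α : ℝ → ℝ) (D S : Set (Euc n)) (h : Euc n → ℝ) : Prop where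
  isCompact : IsCompact S
  subset_interior : S ⊆ interior D
  contDiff : ContDiff ℝ 1 h
  pos : ∀ x ∈ interior S, 0 < h x
  neg : ∀ x ∈ D \ S, h x < 0
  zero : ∀ x ∈ frontier S, h x = 0
  deriv : ∀ x ∈ D, ((-α (h x) : ℝ) : EReal) ≤
    ⨆ u ∈ U, ((inner ℝ (gradient h x) (f x + g x u) : ℝ) : EReal)

/-- The pointwise maximum `H = max_i h_i`. -/
def maxFun {n k : ℕ} [NeZero k] (h : Fin k → Euc n → ℝ) (x : Euc n) : ℝ :=
  Finset.univ.sup' Finset.univ_nonempty (fun i => h i x)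

/-- Clarke's generalized gradient: the convex hull of all limits of gradients of `H` at points of
differentiability that converge to `x`. -/
def clarkeGradient {n : ℕ} (H : Euc n → ℝ) (x : Euc n) : Set (Euc n) :=
  convexHull ℝ {ξ | ∃ y : ℕ → Euc n, Tendsto y atTop (𝓝 x) ∧ (∀ l, DifferentiableAt ℝ H (y l)) ∧
    Tendsto (fun l => gradient H (y l)) atTop (𝓝 ξ)}

/-- `H` is a non-smooth control barrier function for the compact set `C`: it is locally Lipschitz,
`C` is its zero-superlevel set in the whole space, it vanishes on the boundary of `C`, and at every
point of `C` the barrier inequality holds for all generalized gradients simultaneously. -/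
structure IsNonsmoothCBF {n m : ℕ} (f : Euc n → Euc n) (g : Euc n → Euc m →L[ℝ] Euc n)
    (U : Set (Euc m)) (α : ℝ → ℝ) (C : Set (Euc n)) (H : Euc n → ℝ) : Prop where
  locallyLipschitz : LocallyLipschitz H
  isCompact : IsCompact C
  superlevel : C = {x | 0 ≤ H x}
  zero : ∀ x ∈ frontier C, H x = 0
  deriv : ∀ x ∈ C, ((-α (H x) : ℝ) : EReal) ≤
    ⨆ u ∈ U, ⨅ ξ ∈ clarkeGradient H x, ((inner ℝ ξ (f x + g x u) : ℝ) : EReal)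

/-! ### The safety filter -/

/-- The inputs that satisfy the constraints of the almost-active-set QP at the state `x`. -/
def qpFeasible {n m k : ℕ} [NeZero k] (f : Euc n → Euc n) (g : Euc n → Euc m →L[ℝ] Euc n)
    (U : Set (Euc m)) (α : ℝ → ℝ) (h : Fin k → Euc n → ℝ) (ε : ℝ) (x : Euc n) : Set (Euc m) :=
  {u | u ∈ U ∧ ∀ i, |h i x - maxFun h x| ≤ ε →
    -α (maxFun h x) ≤ inner ℝ (gradient (h i) x) (f x + g x u)}

/-- `u` solves the QP at the state `x` with reference input `w`: it minimizes `‖u - w‖²` over the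
feasible inputs. -/
def IsQPSolution {n m k : ℕ} [NeZero k] (f : Euc n → Euc n) (g : Euc n → Euc m →L[ℝ] Euc n)
    (U : Set (Euc m)) (α : ℝ → ℝ) (h : Fin k → Euc n → ℝ) (ε : ℝ) (w : Euc m) (x : Euc n)
    (u : Euc m) : Prop :=
  u ∈ qpFeasible f g U α h ε x ∧ ∀ u' ∈ qpFeasible f g U α h ε x, ‖u - w‖ ^ 2 ≤ ‖u' - w‖ ^ 2

/-- Persistent feasibility on `C`: at every time the QP has a solution at all states of `C`, with a
bound that does not depend on the state. -/
def PersistentlyFeasible {n m k : ℕ} [NeZero k] (f : Euc n → Euc n)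
    (g : Euc n → Euc m →L[ℝ] Euc n) (U : Set (Euc m)) (α : ℝ → ℝ) (h : Fin k → Euc n → ℝ) (ε : ℝ)
    (ur : ℝ → Euc m) (C : Set (Euc n)) : Prop :=
  ∀ t, 0 ≤ t → ∃ M : ℝ, ∀ x ∈ C, ∃ u, IsQPSolution f g U α h ε (ur t) x u ∧ ‖u‖ ≤ M

/-! ### Closed-loop solutions and forward invariance -/

/-- `x` is an absolutely continuous solution on `[0, T]` of the differential inclusion
`ẋ(t) ∈ Γ(t, x(t))` for almost every `t`. -/
structure IsSolutionOn {n : ℕ} (Γ : ℝ → Euc n → Set (Euc n)) (T : ℝ) (x : ℝ → Euc n) : Prop where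
  absCont : AbsolutelyContinuousOnInterval x 0 T
  velocity : ∀ᵐ t ∂(volume.restrict (Icc 0 T)), ∃ v ∈ Γ t (x t), HasDerivAt x v t

/-- `C` is forward invariant: every solution, on every time interval, that starts in `C` stays in
`C`. -/
def ForwardInvariant {n : ℕ} (Γ : ℝ → Euc n → Set (Euc n)) (C : Set (Euc n)) : Prop :=
  ∀ (T : ℝ) (x : ℝ → Euc n), 0 ≤ T → IsSolutionOn Γ T x → x 0 ∈ C → ∀ t ∈ Icc 0 T, x t ∈ C

/-- The velocities that the safety filter allows at time `t` in the state `x`, when the filter is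
in operation on the set `W`: at a state of `W` the applied input solves the QP for the reference
`ur t`; at other states the velocity is arbitrary. -/
def filteredVelocities {n m k : ℕ} [NeZero k] (f : Euc n → Euc n)
    (g : Euc n → Euc m →L[ℝ] Euc n) (U : Set (Euc m)) (α : ℝ → ℝ) (h : Fin k → Euc n → ℝ) (ε : ℝ)
    (ur : ℝ → Euc m) (W : Set (Euc n)) (t : ℝ) (x : Euc n) : Set (Euc n) :=
  {v | x ∈ W → ∃ u, IsQPSolution f g U α h ε (ur t) x u ∧ v = f x + g x u}

/-- Filippov's regularization of a vector field. -/
def filippov {n : ℕ} (F : Euc n → Euc n) (x : Euc n) : Set (Euc n) :=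
  ⋂ (δ : ℝ) (_ : 0 < δ) (N : Set (Euc n)) (_ : volume N = 0),
    closure (convexHull ℝ (F '' (Metric.ball x δ \ N)))

/-- A feedback law `κ(t, x)` that is measurable, locally bounded in the state, and solves the QP for
the reference `ur t` at all states of `W`. -/
structure IsQPFeedback {n m k : ℕ} [NeZero k] (f : Euc n → Euc n)
    (g : Euc n → Euc m →L[ℝ] Euc n) (U : Set (Euc m)) (α : ℝ → ℝ) (h : Fin k → Euc n → ℝ) (ε : ℝ)
    (ur : ℝ → Euc m) (W : Set (Euc n)) (κ : ℝ → Euc n → Euc m) : Prop where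
  measurable : Measurable (Function.uncurry κ)
  locallyBounded : ∀ t, 0 ≤ t → ∀ x, ∃ V ∈ 𝓝 x, ∃ M : ℝ, ∀ y ∈ V, ‖κ t y‖ ≤ M
  solves : ∀ t, 0 ≤ t → ∀ x ∈ W, IsQPSolution f g U α h ε (ur t) x (κ t x)

end MaxCBF

end

namespace MaxCBF

/-! ### Decay of radial basis functions away from their centres -/

section Profile

/-! Let `x ∉ D i`. The segment from a positively weighted centre to `x` crosses `frontier (D i)`,
hence has length at least `s`, and that basis function vanishes at `x`. The other terms are
nonpositive, so `h i x ≤ -b < 0` (`rbfCBF_neg_of_notMem`). No local CBF is therefore positive by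
accident far away, and `C` is exactly `{0 ≤ H}`.

For invariance, suppose a trajectory leaves `C`. Just afterwards it is in `W` with `H < 0`, so
`-α(H) > 0` and the constraint of an active `h i` forces it not to decrease. Since `h i` touches `H`
from below, `H ∘ x` has the same derivative as `h i ∘ x` wherever both exist. As `H ∘ x` is
absolutely continuous, it cannot have dropped below zero (`forwardInvariant_superlevel`).

For Filippov solutions the margin `ε` is essential: a function active at `x` is almost active at all
nearby states, so its constraint survives the closed convex hull (`barrier_of_mem_filippov`). -/

theorem _root_.IsPreconnected.inter_frontier_nonempty {X : Type*} [TopologicalSpace X]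
    {s t : Set X} (hs : IsPreconnected s) (h1 : (s ∩ t).Nonempty) (h2 : (s ∩ tᶜ).Nonempty) :
    (s ∩ frontier t).Nonempty := by
  rw [frontier_eq_closure_inter_closure]
  refine isPreconnected_closed_iff.1 hs _ _ isClosed_closure isClosed_closure (fun y _ => ?_)
    (h1.mono (inter_subset_inter_right _ subset_closure))
    (h2.mono (inter_subset_inter_right _ subset_closure))
  exact (em (y ∈ t)).imp (fun hy => subset_closure hy) (fun hy => subset_closure hy)

variable {p : ℕ} {q : Polynomial ℝ}

theorem wendlandProfile_of_one_le (hp : p ≠ 0) {r : ℝ} (hr : 1 ≤ r) :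
    wendlandProfile p q r = 0 := by
  simp [wendlandProfile, max_eq_left (sub_nonpos.2 hr), hp]

/-- Outside a set containing all centres and whose boundary keeps distance `s` from the centres
with positive weight, only basis functions with nonpositive weight contribute. -/
theorem rbfCBF_neg_of_notMem (hφ : IsWendlandForm p q) {n J : ℕ} {s b : ℝ} (hs : 0 < s)
    (hb : 0 < b) {Z : Fin J → Euc n} {θ : Fin J → ℝ} {D : Set (Euc n)}
    (hcenter : ∀ j, Z j ∈ D) (hdecay : ∀ j, 0 < θ j → ∀ y ∈ frontier D, s ≤ dist (Z j) y)
    {x : Euc n} (hx : x ∉ D) : rbfCBF (wendlandProfile p q) s b Z θ x < 0 := by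
  -- With `p = 0` the truncated factor would be `0 ^ 0 = 1` and the profile would not vanish beyond
  -- radius 1.
  have hp : p ≠ 0 := (Nat.zero_le _).trans_lt hφ.degree_lt |>.ne'
  have hsum : ∑ j, wendlandProfile p q (‖x - Z j‖ / s) * θ j ≤ 0 := by
    refine Finset.sum_nonpos fun j _ => ?_
    rcases le_or_gt (θ j) 0 with hj | hj
    · exact mul_nonpos_of_nonneg_of_nonpos (hφ.nonneg _ (by positivity)) hj
    · obtain ⟨y, hy, hyD⟩ : (segment ℝ (Z j) x ∩ frontier D).Nonempty :=
        (convex_segment (Z j) x).isPreconnected.inter_frontier_nonempty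
          ⟨Z j, left_mem_segment ℝ _ _, hcenter j⟩ ⟨x, right_mem_segment ℝ _ _, hx⟩
      have h1 : dist (Z j) y ≤ dist (Z j) x := by
        have := dist_add_dist_of_mem_segment hy
        linarith [dist_nonneg (x := y) (y := x)]
      have h2 : s ≤ ‖x - Z j‖ := by
        rw [← dist_eq_norm, dist_comm]
        exact (hdecay j hj y hyD).trans h1
      rw [wendlandProfile_of_one_le hp ((one_le_div hs).2 h2), zero_mul]
  unfold rbfCBF
  linarith

end Profile

/-! ### The pointwise maximum and its generalized gradient -/

section MaxFun

variable {n k : ℕ} [NeZero k] {h : Fin k → Euc n → ℝ}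

theorem le_maxFun (i : Fin k) (x : Euc n) : h i x ≤ maxFun h x :=
  Finset.le_sup' (fun i => h i x) (Finset.mem_univ i)

theorem exists_eq_maxFun (h : Fin k → Euc n → ℝ) (x : Euc n) : ∃ i, h i x = maxFun h x := by
  obtain ⟨i, -, hi⟩ := Finset.exists_mem_eq_sup' Finset.univ_nonempty (fun i => h i x)
  exact ⟨i, hi.symm⟩

theorem continuous_maxFun (hc : ∀ i, Continuous (h i)) : Continuous (maxFun h) :=
  Continuous.finset_sup'_apply Finset.univ_nonempty fun i _ => hc i

theorem locallyLipschitz_maxFun (hL : ∀ i, LocallyLipschitz (h i)) :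
    LocallyLipschitz (maxFun h) := by
  intro x
  choose K V hV hK using fun i => hL i x
  refine ⟨Finset.univ.sup K, ⋂ i, V i, Filter.iInter_mem.2 hV, ?_⟩
  refine LipschitzOnWith.of_le_add_mul _ fun y hy z hz => ?_
  obtain ⟨i, hi⟩ := exists_eq_maxFun h y
  rw [← hi]
  calc h i y ≤ h i z + K i * dist y z :=
        (hK i).le_add_mul (mem_iInter.1 hy i) (mem_iInter.1 hz i)
    _ ≤ maxFun h z + (Finset.univ.sup K : NNReal) * dist y z := by
        gcongr
        · exact le_maxFun i z
        · exact Finset.le_sup (Finset.mem_univ i)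

/-- Two differentiable functions that touch, one lying below the other, have the same
derivative at the point of contact. -/
theorem fderiv_eq_of_le_of_eq {E : Type*} [NormedAddCommGroup E] [NormedSpace ℝ E]
    {u v : E → ℝ} {x : E} (hu : DifferentiableAt ℝ u x) (hv : DifferentiableAt ℝ v x)
    (hle : ∀ y, u y ≤ v y) (heq : u x = v x) : fderiv ℝ u x = fderiv ℝ v x := by
  have hmin : IsLocalMin (fun y => v y - u y) x :=
    Filter.Eventually.of_forall fun y => by simpa [heq] using hle y
  have h0 := hmin.fderiv_eq_zero
  rw [fderiv_fun_sub hv hu, sub_eq_zero] at h0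
  exact h0.symm

theorem continuous_gradient {u : Euc n → ℝ} (hu : ContDiff ℝ 1 u) : Continuous (gradient u) :=
  (InnerProductSpace.toDual ℝ (Euc n)).symm.continuous.comp (hu.continuous_fderiv one_ne_zero)

/-- Clarke's gradient of a maximum of `C¹` functions is spanned by the gradients of the active
functions. -/
theorem clarkeGradient_maxFun_subset (hC : ∀ i, ContDiff ℝ 1 (h i)) (x : Euc n) :
    clarkeGradient (maxFun h) x ⊆
      convexHull ℝ {ξ | ∃ i, h i x = maxFun h x ∧ gradient (h i) x = ξ} := by
  refine convexHull_mono ?_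
  rintro ξ ⟨y, hy, hdiff, hlim⟩
  choose i hi using fun l => exists_eq_maxFun h (y l)
  -- Pigeonhole: among finitely many indices one is active infinitely often. Along that subsequence
  -- the gradient of the maximum is that of a single `C¹` function, so the limit is its gradient at
  -- `x`.
  obtain ⟨a, ha⟩ : ∃ a, ∃ᶠ l in atTop, i l = a := by
    by_contra! hne
    obtain ⟨l, hl⟩ := (Filter.eventually_all.2 hne).exists
    exact hl _ rfl
  obtain ⟨φ, hφ, hφa⟩ := Filter.extraction_of_frequently_atTop ha
  have hy' := hy.comp hφ.tendsto_atTop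
  have hgrad : ∀ l, gradient (maxFun h) (y (φ l)) = gradient (h a) (y (φ l)) := fun l => by
    unfold gradient
    rw [fderiv_eq_of_le_of_eq ((hC a).differentiable one_ne_zero _) (hdiff (φ l)) (le_maxFun a)
      (hφa l ▸ hi (φ l))]
  refine ⟨a, tendsto_nhds_unique (((hC a).continuous.tendsto x).comp hy') ?_,
    tendsto_nhds_unique (((continuous_gradient (hC a)).tendsto x).comp hy') ?_⟩
  · refine (((continuous_maxFun fun i => (hC i).continuous).tendsto x).comp hy').congr fun l => ?_
    exact (hφa l ▸ hi (φ l)).symm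
  · exact (hlim.comp hφ.tendsto_atTop).congr hgrad

end MaxFun

section HalfSpace

variable {E : Type*} [NormedAddCommGroup E] [InnerProductSpace ℝ E]

theorem convex_setOf_le_inner_left (w : E) (c : ℝ) : Convex ℝ {ξ : E | c ≤ inner ℝ ξ w} := by
  simp_rw [real_inner_comm w]
  exact convex_halfSpace_ge (innerₛₗ ℝ w).isLinear c

theorem convex_setOf_le_inner_right (w : E) (c : ℝ) : Convex ℝ {ξ : E | c ≤ inner ℝ w ξ} :=
  convex_halfSpace_ge (innerₛₗ ℝ w).isLinear c

end HalfSpace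

/-! ### Absolutely continuous trajectories and forward invariance -/

section Invariance

theorem _root_.LipschitzOnWith.comp_absolutelyContinuousOnInterval {X Y : Type*}
    [PseudoMetricSpace X] [PseudoMetricSpace Y] {F : X → Y} {K : NNReal} {s : Set X} {x : ℝ → X}
    {a b : ℝ} (hF : LipschitzOnWith K F s) (hx : AbsolutelyContinuousOnInterval x a b)
    (hs : MapsTo x (uIcc a b) s) : AbsolutelyContinuousOnInterval (F ∘ x) a b := by
  unfold AbsolutelyContinuousOnInterval at hx ⊢
  have hlim := hx.const_mul (K : ℝ)
  rw [mul_zero] at hlim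
  refine squeeze_zero' ?_ ?_ hlim
  · exact Filter.Eventually.of_forall fun _ => Finset.sum_nonneg fun _ _ => dist_nonneg
  · rw [eventually_inf_principal]
    refine Filter.Eventually.of_forall fun E hE => ?_
    rw [Finset.mul_sum]
    exact Finset.sum_le_sum fun i hi =>
      hF.dist_le_mul _ (hs (hE.1 i hi).1) _ (hs (hE.1 i hi).2)

/-- The curve has compact image, on which a locally Lipschitz function is Lipschitz with one
constant. -/
theorem _root_.LocallyLipschitz.comp_absolutelyContinuousOnInterval {X Y : Type*}
    [SeminormedAddCommGroup X] [PseudoMetricSpace Y] {F : X → Y} {x : ℝ → X} {a b : ℝ}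
    (hF : LocallyLipschitz F) (hx : AbsolutelyContinuousOnInterval x a b) :
    AbsolutelyContinuousOnInterval (F ∘ x) a b := by
  obtain ⟨K, hK⟩ := (hF.locallyLipschitzOn (s := x '' uIcc a b)).exists_lipschitzOnWith_of_compact
    (isCompact_uIcc.image_of_continuousOn hx.continuousOn)
  exact hK.comp_absolutelyContinuousOnInterval hx (mapsTo_image _ _)

/-- Nagumo-type criterion: a superlevel set of a locally Lipschitz function is forward invariant
if near it, but outside of it, every allowed velocity is a direction of nondecrease for a
differentiable minorant that touches the function. -/
theorem forwardInvariant_superlevel {n : ℕ} {Γ : ℝ → Euc n → Set (Euc n)} {H : Euc n → ℝ}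
    (hH : LocallyLipschitz H) {W : Set (Euc n)} (hW : IsOpen W) (hHW : {x | 0 ≤ H x} ⊆ W)
    (hΓ : ∀ t, 0 ≤ t → ∀ x ∈ W, H x < 0 → ∀ v ∈ Γ t x, ∃ u : Euc n → ℝ,
      DifferentiableAt ℝ u x ∧ u x = H x ∧ (∀ y, u y ≤ H y) ∧ 0 ≤ inner ℝ (gradient u x) v) :
    ForwardInvariant Γ {x | 0 ≤ H x} := by
  intro T x hT hx hx0 t₁ ht₁
  by_contra hneg
  have hcont : ContinuousOn x (Icc 0 T) := by
    simpa [uIcc_of_le hT] using hx.absCont.continuousOn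
  have hcont₁ : ContinuousOn x (Icc 0 t₁) := hcont.mono (Icc_subset_Icc_right ht₁.2)
  have hcl : IsClosed {x | 0 ≤ H x} := isClosed_le continuous_const hH.continuous
  -- `t₀` is the last time before `t₁` at which the trajectory is in the set.
  obtain ⟨t₀, ⟨ht₀, hxt₀⟩, hmax⟩ : ∃ t₀, IsGreatest (Icc 0 t₁ ∩ x ⁻¹' {x | 0 ≤ H x}) t₀ :=
    (isCompact_Icc.of_isClosed_subset (hcont₁.preimage_isClosed_of_isClosed isClosed_Icc hcl)
      inter_subset_left).exists_isGreatest ⟨0, left_mem_Icc.2 ht₁.1, hx0⟩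
  have hlt : t₀ < t₁ := ht₀.2.lt_of_ne fun heq => hneg (heq ▸ hxt₀)
  have hout : ∀ t ∈ Ioc t₀ t₁, H (x t) < 0 := fun t ht => by
    by_contra hge
    exact ht.1.not_ge (hmax ⟨⟨ht₀.1.trans ht.1.le, ht.2⟩, not_lt.1 hge⟩)
  obtain ⟨t₂, ht₂, hW₂⟩ : ∃ t₂ ∈ Ioc t₀ t₁, Icc t₀ t₂ ⊆ x ⁻¹' W := by
    have hev : x ⁻¹' W ∈ 𝓝[≥] t₀ := by
      have h1 : ContinuousWithinAt x (Icc t₀ t₁) t₀ :=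
        (hcont₁ t₀ ht₀).mono (Icc_subset_Icc_left ht₀.1)
      rw [← nhdsWithin_Icc_eq_nhdsGE hlt]
      exact h1.preimage_mem_nhdsWithin (hW.mem_nhds (hHW hxt₀))
    obtain ⟨c, hc, hcW⟩ := mem_nhdsGE_iff_exists_Icc_subset.1 hev
    exact ⟨min c t₁, ⟨lt_min hc hlt, min_le_right _ _⟩,
      (Icc_subset_Icc_right (min_le_left _ _)).trans hcW⟩
  have hsub : uIcc t₀ t₂ ⊆ uIcc 0 T := by
    rw [uIcc_of_le ht₂.1.le, uIcc_of_le hT]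
    exact Icc_subset_Icc ht₀.1 (ht₂.2.trans ht₁.2)
  have hAC := hH.comp_absolutelyContinuousOnInterval (hx.absCont.mono hsub)
  have hderiv : 0 ≤ᵐ[volume.restrict (Ioc t₀ t₂)] deriv (H ∘ x) := by
    have hvel := ae_restrict_of_ae_restrict_of_subset
      (Ioc_subset_Icc_self.trans (Icc_subset_Icc ht₀.1 (ht₂.2.trans ht₁.2))) hx.velocity
    filter_upwards [hvel, ae_restrict_mem measurableSet_Ioc] with t ⟨v, hv, hxv⟩ ht
    -- Where `H ∘ x` is not differentiable, `deriv` is 0 by default, which has the required sign.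
    by_cases hd : DifferentiableAt ℝ (H ∘ x) t
    · obtain ⟨u, hu, hux, hle, hnonneg⟩ := hΓ t (ht₀.1.trans ht.1.le) (x t)
        (hW₂ ⟨ht.1.le, ht.2⟩) (hout t ⟨ht.1, ht.2.trans ht₂.2⟩) v hv
      have hcomp : HasDerivAt (u ∘ x) (inner ℝ (gradient u (x t)) v) t := by
        simpa using hu.hasGradientAt.hasFDerivAt.comp_hasDerivAt t hxv
      have heq := fderiv_eq_of_le_of_eq hcomp.differentiableAt hd (fun τ => hle (x τ)) hux
      have : deriv (H ∘ x) t = inner ℝ (gradient u (x t)) v := by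
        rw [← hcomp.deriv, ← fderiv_apply_one_eq_deriv, ← fderiv_apply_one_eq_deriv, heq]
      simpa [this] using hnonneg
    · simp [deriv_zero_of_not_differentiableAt hd]
  have hint := hAC.integral_deriv_eq_sub
  have hge : 0 ≤ ∫ t in t₀..t₂, deriv (H ∘ x) t := by
    rw [intervalIntegral.integral_of_le ht₂.1.le]
    exact setIntegral_nonneg_of_ae_restrict hderiv
  have h1 := hout t₂ ht₂
  have h2 : 0 ≤ H (x t₀) := hxt₀
  simp only [Function.comp_apply] at hint
  linarith

end Invariance

/-! ### Barrier inequalities enforced by the QP -/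

section Filter

variable {n m k : ℕ} [NeZero k] {f : Euc n → Euc n} {g : Euc n → Euc m →L[ℝ] Euc n}
  {U : Set (Euc m)} {α : ℝ → ℝ} {h : Fin k → Euc n → ℝ} {ε : ℝ} {ur : ℝ → Euc m}
  {W : Set (Euc n)}

theorem IsCBF.nonneg {D S : Set (Euc n)} {u : Euc n → ℝ} (hu : IsCBF f g U α D S u) {x : Euc n}
    (hx : x ∈ S) : 0 ≤ u x := by
  by_cases hi : x ∈ interior S
  · exact (hu.pos x hi).le
  · exact (hu.zero x ⟨subset_closure hx, hi⟩).ge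

theorem barrier_of_mem_qpFeasible (hε : 0 ≤ ε) {x : Euc n} {u : Euc m}
    (hu : u ∈ qpFeasible f g U α h ε x) {i : Fin k} (hi : h i x = maxFun h x) :
    -α (maxFun h x) ≤ inner ℝ (gradient (h i) x) (f x + g x u) :=
  hu.2 i (by simpa [hi] using hε)

/-- Filippov's regularization of a closed loop with almost-active-set QP feedback satisfies the
barrier inequality for every active function. -/
theorem barrier_of_mem_filippov (hf : Continuous f) (hg : Continuous g) (hα : Continuous α)
    (hC : ∀ i, ContDiff ℝ 1 (h i)) (hε : 0 < ε) (hW : IsOpen W) {κ : ℝ → Euc n → Euc m}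
    (hκ : IsQPFeedback f g U α h ε ur W κ) {t : ℝ} (ht : 0 ≤ t) {x : Euc n} (hx : x ∈ W)
    {i : Fin k} (hi : h i x = maxFun h x) {v : Euc n}
    (hv : v ∈ filippov (fun x => f x + g x (κ t x)) x) :
    -α (maxFun h x) ≤ inner ℝ (gradient (h i) x) v := by
  have hmax : Continuous (maxFun h) := continuous_maxFun fun i => (hC i).continuous
  have hgrad := continuous_gradient (hC i)
  refine le_of_forall_pos_le_add fun η hη => ?_
  obtain ⟨V, hV, M, hM⟩ := hκ.locallyBounded t ht x
  have hactive : ∀ᶠ y in 𝓝 x, |h i y - maxFun h y| < ε := by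
    have : Continuous fun y => |h i y - maxFun h y| := ((hC i).continuous.sub hmax).abs
    exact this.continuousAt.eventually_lt_const (by simpa [hi] using hε)
  -- The constraint at `y` involves the gradient at `y`. The subtracted term bounds, by
  -- Cauchy–Schwarz, the cost of replacing it by the gradient at `x`.
  have hlim : Tendsto (fun y => -α (maxFun h y) -
      ‖gradient (h i) y - gradient (h i) x‖ * (‖f y‖ + ‖g y‖ * M)) (𝓝 x)
      (𝓝 (-α (maxFun h x))) := by
    have : Continuous fun y => -α (maxFun h y) -
        ‖gradient (h i) y - gradient (h i) x‖ * (‖f y‖ + ‖g y‖ * M) := by fun_prop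
    simpa using this.tendsto x
  have hev : ∀ᶠ y in 𝓝 x,
      -α (maxFun h x) - η ≤ inner ℝ (gradient (h i) x) (f y + g y (κ t y)) := by
    filter_upwards [hV, hactive, hW.mem_nhds hx,
      hlim.eventually_const_lt (sub_lt_self _ hη)] with y hyV hya hyW hyη
    have hqp := (hκ.solves t ht y hyW).1.2 i hya.le
    have hbound : ‖f y + g y (κ t y)‖ ≤ ‖f y‖ + ‖g y‖ * M :=
      (norm_add_le _ _).trans (by
        gcongr
        exact (g y).le_opNorm_of_le (hM y hyV))
    have hcs := real_inner_le_norm (gradient (h i) y - gradient (h i) x) (f y + g y (κ t y))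
    have hmul := mul_le_mul_of_nonneg_left hbound
      (norm_nonneg (gradient (h i) y - gradient (h i) x))
    rw [inner_sub_left] at hcs
    linarith
  obtain ⟨δ, hδ, hball⟩ := Metric.eventually_nhds_iff_ball.1 hev
  -- The bound holds at every point of the ball, so the null set can be empty.
  have hmem := mem_iInter₂.1 (mem_iInter₂.1 hv δ hδ) ∅ measure_empty
  have hsub : closure (convexHull ℝ ((fun x => f x + g x (κ t x)) '' (Metric.ball x δ \ ∅))) ⊆
      {ξ | -α (maxFun h x) - η ≤ inner ℝ (gradient (h i) x) ξ} := by
    refine closure_minimal (convexHull_min ?_ (convex_setOf_le_inner_right _ _))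
      (isClosed_le continuous_const (by fun_prop))
    rintro _ ⟨y, hy, rfl⟩
    exact hball y hy.1
  have : -α (maxFun h x) - η ≤ inner ℝ (gradient (h i) x) v := hsub hmem
  linarith

/-- At a state where the almost-active-set QP is feasible, the maximum satisfies the nonsmooth
barrier inequality. -/
theorem le_iSup_iInf_clarkeGradient (hC : ∀ i, ContDiff ℝ 1 (h i)) (hε : 0 ≤ ε) {x : Euc n}
    {u : Euc m} (hu : u ∈ qpFeasible f g U α h ε x) :
    ((-α (maxFun h x) : ℝ) : EReal) ≤
      ⨆ u ∈ U, ⨅ ξ ∈ clarkeGradient (maxFun h) x, ((inner ℝ ξ (f x + g x u) : ℝ) : EReal) := by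
  refine le_iSup₂_of_le u hu.1 (le_iInf₂ fun ξ hξ => ?_)
  -- For a fixed input the inequality cuts out a half-space of gradients, so it passes from active
  -- gradients to their convex hull.
  have hsub : convexHull ℝ {ξ | ∃ i, h i x = maxFun h x ∧ gradient (h i) x = ξ} ⊆
      {ξ | -α (maxFun h x) ≤ inner ℝ ξ (f x + g x u)} := by
    refine convexHull_min ?_ (convex_setOf_le_inner_left _ _)
    rintro _ ⟨i, hi, rfl⟩
    exact barrier_of_mem_qpFeasible hε hu hi
  exact EReal.coe_le_coe_iff.2 (hsub (clarkeGradient_maxFun_subset hC x hξ))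

end Filter

end MaxCBF

theorem theorem1 {n m k : ℕ} [NeZero k]
    -- the control system, its inputs, and the reference control signal
    (f : MaxCBF.Euc n → MaxCBF.Euc n) (hf : Continuous f)
    (g : MaxCBF.Euc n → MaxCBF.Euc m →L[ℝ] MaxCBF.Euc n) (hg : Continuous g)
    (U : Set (MaxCBF.Euc m)) (ur : ℝ → MaxCBF.Euc m) (hur : ∀ t, 0 ≤ t → ur t ∈ U)
    (α : ℝ → ℝ) (hα : MaxCBF.IsExtClassK α)
    -- the basis functions and the local CBFs
    (p : ℕ) (q : Polynomial ℝ) (hφ : MaxCBF.IsWendlandForm p q)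
    (s b : ℝ) (hs : 0 < s) (hb : 0 < b)
    (J : Fin k → ℕ) (Z : (i : Fin k) → Fin (J i) → MaxCBF.Euc n)
    (θ : (i : Fin k) → Fin (J i) → ℝ)
    (h : Fin k → MaxCBF.Euc n → ℝ)
    (hh : ∀ i, h i = MaxCBF.rbfCBF (MaxCBF.wendlandProfile p q) s b (Z i) (θ i))
    (D S : Fin k → Set (MaxCBF.Euc n))
    (hcbf : ∀ i, MaxCBF.IsCBF f g U α (D i) (S i) (h i))
    -- persistent feasibility
    (ε : ℝ) (hε : 0 < ε)
    (hfeas : MaxCBF.PersistentlyFeasible f g U α h ε ur (⋃ i, S i))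
    -- decay buffer
    (hcenter : ∀ i j, Z i j ∈ D i)
    (hdecay : ∀ i j, 0 < θ i j → ∀ y ∈ frontier (D i), s ≤ dist (Z i j) y) :
    (∀ i, ∀ x ∉ D i, h i x < 0) ∧
    (⋃ i, S i) ⊆ (⋃ i, D i) ∧
    MaxCBF.IsNonsmoothCBF f g U α (⋃ i, S i) (MaxCBF.maxFun h) ∧
    -- forward invariance under the safety filter, and under (discontinuous) QP feedback in the
    -- sense of Filippov
    (∀ W : Set (MaxCBF.Euc n), IsOpen W → (⋃ i, S i) ⊆ W →
      MaxCBF.ForwardInvariant (MaxCBF.filteredVelocities f g U α h ε ur W) (⋃ i, S i) ∧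
      ∀ κ : ℝ → MaxCBF.Euc n → MaxCBF.Euc m, MaxCBF.IsQPFeedback f g U α h ε ur W κ →
        MaxCBF.ForwardInvariant
          (fun t => MaxCBF.filippov (fun x => f x + g x (κ t x))) (⋃ i, S i)) := by
  have hneg : ∀ i, ∀ x ∉ D i, h i x < 0 := fun i x hx => by
    rw [hh i]
    exact MaxCBF.rbfCBF_neg_of_notMem hφ hs hb (hcenter i) (hdecay i) hx
  have hC : ∀ i, ContDiff ℝ 1 (h i) := fun i => (hcbf i).contDiff
  have hLip : LocallyLipschitz (MaxCBF.maxFun h) :=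
    MaxCBF.locallyLipschitz_maxFun fun i => (hC i).locallyLipschitz
  have hsuper : (⋃ i, S i) = {x | 0 ≤ MaxCBF.maxFun h x} := by
    ext x
    simp only [mem_iUnion, mem_ofPred_eq]
    constructor
    · rintro ⟨i, hi⟩
      exact ((hcbf i).nonneg hi).trans (MaxCBF.le_maxFun i x)
    · intro hx
      obtain ⟨i, hi⟩ := MaxCBF.exists_eq_maxFun h x
      rw [← hi] at hx
      refine ⟨i, by_contra fun hS => hx.not_gt ?_⟩
      by_cases hD : x ∈ D i
      · exact (hcbf i).neg x ⟨hD, hS⟩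
      · exact hneg i x hD
  have hαneg : ∀ r < 0, 0 ≤ -α r := fun r hr => by
    have := hα.strictMono hr
    rw [hα.map_zero] at this
    linarith
  refine ⟨hneg, iUnion_mono fun i => (hcbf i).subset_interior.trans interior_subset,
    ⟨hLip, isCompact_iUnion fun i => (hcbf i).isCompact, hsuper, ?_, ?_⟩, fun W hW hSW => ?_⟩
  · intro x hx
    rw [hsuper] at hx
    exact (frontier_le_subset_eq continuous_const hLip.continuous hx).symm
  · intro x hx
    -- Only a feasible input is needed, and feasibility does not depend on the reference, so any
    -- time would do.
    obtain ⟨M, hM⟩ := hfeas 0 le_rfl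
    obtain ⟨u, hu, -⟩ := hM x hx
    exact MaxCBF.le_iSup_iInf_clarkeGradient hC hε.le hu.1
  · rw [hsuper] at hSW ⊢
    refine ⟨MaxCBF.forwardInvariant_superlevel hLip hW hSW ?_, fun κ hκ =>
      MaxCBF.forwardInvariant_superlevel hLip hW hSW ?_⟩
    · intro t _ x hx hxneg v hv
      obtain ⟨u, hu, rfl⟩ := hv hx
      obtain ⟨i, hi⟩ := MaxCBF.exists_eq_maxFun h x
      exact ⟨h i, (hC i).differentiable one_ne_zero x, hi, MaxCBF.le_maxFun i,
        (hαneg _ hxneg).trans (MaxCBF.barrier_of_mem_qpFeasible hε.le hu.1 hi)⟩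
    · intro t ht x hx hxneg v hv
      obtain ⟨i, hi⟩ := MaxCBF.exists_eq_maxFun h x
      exact ⟨h i, (hC i).differentiable one_ne_zero x, hi, MaxCBF.le_maxFun i,
        (hαneg _ hxneg).trans (MaxCBF.barrier_of_mem_filippov hf hg
          hα.locallyLipschitz.continuous hC hε hW hκ ht hx hi hv)⟩
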